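/- Let $c_0=0.558$ and $c_1=0.5$. For an integer $k\ge 1$ let $\mathcal D_k$ be the set of probability distributions $P=(p_i)_{i\in\mathbb N}$ on $\mathbb N$ all of whose non-zero masses are at least $1/k$, and let $S=S(P)=\#\{i:p_i>0\}$ be the support size. In the Poissonized sampling model with sample-size parameter $n$ one observes independent counts $N_i\sim\mathrm{Poi}(np_i)$, $i\in\mathbb N$. Given $n$ and $0<\epsilon<1$, put $$l=\frac{c_1}{c_0^2}\,\frac{\log^2(1/\epsilon)}{n\log n},\qquad r=\frac{c_1\log n}{n},\qquad L=\lfloor c_0\log n\rfloor .$$ Let $T_L$ be the Chebyshev polynomial of the first kind of degree $L$, write $$P_L(x)=-\frac{T_L\big(\frac{2x-r-l}{r-l}\big)}{T_L\big(\frac{-r-l}{r-l}\big)}=\sum_{m=1}^L a_mx^m-1,$$ and set $u_j=a_j\,j!/n^j$ for $1\le j\le L$ and $u_j=0$ for $j>L$. The linear estimator, which does not use $k$, is $\tilde S=\sum_i g(N_i)$ with $g(0)=0$ and $g(j)=1+u_j$ for $j\ge1$. Then there exist absolute constants $c<1$, $C>0$ and $C'>0$ such that, for all integers $n,k\ge1$,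 every $\epsilon$ with $n^{-C}<\epsilon<1$ and every $P\in\mathcal D_k$, the random variable $(\tilde S-S)^2$ is integrable and $$\mathbb E(\tilde S-S)^2\le C'\Big(S^2\,\epsilon^{2(1-\sqrt{\alpha})}+S\,n^{c}\Big),\qquad \alpha=\max\Big(1-\frac{c_0^2}{c_1}\,\frac{n\log n}{k\log^2(1/\epsilon)},\,0\Big).$$ (For $n=1$ no $\epsilon$ is admissible.) -/

import Mathlib

open MeasureTheory ProbabilityTheory
open scoped NNReal Nat

noncomputable section

namespace SupportSize

/-- `IsPoissonSample n P N μ`: the histogram `N = (N_i)` of a Poissonized sample from the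
distribution `P` with mean sample size `n`, i.e. the `N_i` are independent and
`N_i ∼ Poi(n p_i)`. -/
def IsPoissonSample {Ω : Type*} [MeasurableSpace Ω] (n : ℕ) (P : PMF ℕ) (N : ℕ → Ω → ℕ)
    (μ : Measure Ω) : Prop :=
  iIndepFun N μ ∧ ∀ i, HasLaw (N i) (poissonMeasure ((n : ℝ≥0) * (P i).toNNReal)) μ

/-- The support size `S(P)`, the number of symbols with positive probability. -/
def supportSize (P : PMF ℕ) : ℝ := (P.support.ncard : ℝ)

/-- The distributions on `ℕ` all of whose non-zero masses are at least `1 / k`. -/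
def paramSpace (k : ℕ) : Set (PMF ℕ) :=
  {P | ∀ i, P i ≠ 0 → 1 / (k : ℝ) ≤ (P i).toReal}

/-- The shifted and scaled Chebyshev polynomial
`P_L(x) = - T_L((2x - r - l) / (r - l)) / T_L((-r - l) / (r - l))`. -/
def chebPoly (l r : ℝ) (L : ℕ) : Polynomial ℝ :=
  Polynomial.C (-((Polynomial.Chebyshev.T ℝ L).eval ((-r - l) / (r - l)))⁻¹) *
    (Polynomial.Chebyshev.T ℝ L).comp
      (Polynomial.C (2 / (r - l)) * Polynomial.X + Polynomial.C ((-r - l) / (r - l)))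

/-- The coefficients `u_j = a_j j! / n ^ j` for `1 ≤ j ≤ L` and `u_j = 0` otherwise, where `a_j` is
the coefficient of `x ^ j` in `P_L`. -/
def chebCoeff (n : ℕ) (l r : ℝ) (L j : ℕ) : ℝ :=
  if 1 ≤ j ∧ j ≤ L then (chebPoly l r L).coeff j * (j ! : ℝ) / (n : ℝ) ^ j else 0

/-- `g(0) = 0` and `g(j) = u_j + 1` for `j ≥ 1`. -/
def chebWeight (n : ℕ) (l r : ℝ) (L j : ℕ) : ℝ :=
  if j = 0 then 0 else chebCoeff n l r L j + 1

/-- The linear estimator `∑ i, g(N_i)`, evaluated at a histogram `N`. In the Poisson model with a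
finitely supported `P`, almost surely only finitely many `N_i` are non-zero. -/
def linearEstimator (n : ℕ) (l r : ℝ) (L : ℕ) (N : ℕ → ℕ) : ℝ :=
  ∑' i, chebWeight n l r L (N i)

/-- The constant `c₀`. -/
def c₀ : ℝ := 0.558

/-- The constant `c₁`. -/
def c₁ : ℝ := 0.5

/-- The left end point `l = (c₁ / c₀²) log²(1/ε) / (n log n)`. -/
def agnosticLeft (n : ℕ) (ε : ℝ) : ℝ :=
  c₁ / c₀ ^ 2 * (Real.log (1 / ε) ^ 2 / (n * Real.log n))

/-- The right end point `r = c₁ log n / n`. -/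
def agnosticRight (n : ℕ) : ℝ := c₁ * Real.log n / n

/-- The degree `L = ⌊c₀ log n⌋`. -/
def agnosticDegree (n : ℕ) : ℕ := ⌊c₀ * Real.log n⌋₊

/-- The estimator `S̃`, which does not use `k`. -/
def agnosticEstimator (n : ℕ) (ε : ℝ) (N : ℕ → ℕ) : ℝ :=
  linearEstimator n (agnosticLeft n ε) (agnosticRight n) (agnosticDegree n) N

/-- `α = max (1 - (c₀² / c₁) n log n / (k log²(1/ε))) 0`. -/
def alpha (n k : ℕ) (ε : ℝ) : ℝ :=
  max (1 - c₀ ^ 2 / c₁ * (n * Real.log n / (k * Real.log (1 / ε) ^ 2))) 0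

end SupportSize

end

namespace SupportSize

open Polynomial Polynomial.Chebyshev

/-! ### Chebyshev polynomials outside `[-1, 1]` -/

/-! Almost surely the error is the sum of `g(N_i) - 1` over the finite support, with independent
terms. So the risk is at most (S · largest bias)² + S · sup|g - 1|².

Bias: since `P_L(0) = -1`, the factors `j!/n^j` cancel the Poisson weights, and a symbol of mass `p`
has bias `e^{-np} P_L(p)`. On `[l, r]` the numerator of `P_L` is at most 1 while its denominator is
at least `exp(2L√(l/r))/2`, where `L√(l/r)` is about `log(1/ε)`. For `1/k ≤ p < l` the numerator
grows, and comparing two values of `T_L` (`eval_T_le_exp_mul_eval_T`) loses only the factor `1 - √α`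
in the exponent. For `p > r` the factor `e^{-np}` wins.

Both this last case and the bound on `g` rest on `eval_T_agnostic_le`: `T_L(1 + 2z/(r-l)) ≤
n^{0.4997} e^{nz}`. Since the coefficients of `P_L` alternate in sign, each is controlled by a value
of `T_L` to the right of 1, whence `u_j = O(n^{0.499875})`, and squaring keeps the exponent below 1.
-/

lemma coeff_mul_nonneg {p q : ℝ[X]} (hp : ∀ j, 0 ≤ p.coeff j) (hq : ∀ j, 0 ≤ q.coeff j) (j : ℕ) :
    0 ≤ (p * q).coeff j := by
  rw [coeff_mul]
  exact Finset.sum_nonneg fun x _ => mul_nonneg (hp _) (hq _)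

/-- Both `T_n` and `T_{n+1} - T_n` have non-negative coefficients as polynomials in `x - 1`. -/
lemma coeff_T_comp_one_add_nonneg {w : ℝ[X]} (hw : ∀ j, 0 ≤ w.coeff j) (n : ℕ) :
    (∀ j, 0 ≤ ((T ℝ n).comp (1 + w)).coeff j) ∧
      ∀ j, 0 ≤ ((T ℝ (n + 1)).comp (1 + w) - (T ℝ n).comp (1 + w)).coeff j := by
  induction n with
  | zero =>
    refine ⟨fun j => ?_, fun j => ?_⟩
    · simp only [Nat.cast_zero, T_zero, one_comp, coeff_one]
      split_ifs <;> norm_num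
    · simpa using hw j
  | succ n ih =>
    have h1 : ∀ j, 0 ≤ ((T ℝ (n + 1)).comp (1 + w)).coeff j := fun j => by
      have := add_nonneg (ih.2 j) (ih.1 j)
      rwa [coeff_sub, sub_add_cancel] at this
    refine ⟨by simpa using h1, fun j => ?_⟩
    -- The recurrence at `x = 1 + w` reads `T_{n+2} - T_{n+1} = 2w T_{n+1} + (T_{n+1} - T_n)`.
    have e : (T ℝ (n + 2)).comp (1 + w) - (T ℝ (n + 1)).comp (1 + w) =
        w * (T ℝ (n + 1)).comp (1 + w) + w * (T ℝ (n + 1)).comp (1 + w)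
          + ((T ℝ (n + 1)).comp (1 + w) - (T ℝ n).comp (1 + w)) := by
      rw [T_add_two]
      simp only [sub_comp, mul_comp, X_comp, ofNat_comp]
      ring
    have h2 := coeff_mul_nonneg hw h1 j
    have h3 := ih.2 j
    have : ((n + 1 : ℕ) : ℤ) + 1 = (n : ℤ) + 2 := by push_cast; ring
    rw [this, Nat.cast_succ, e, coeff_add, coeff_add]
    positivity

lemma coeff_mul_pow_le_eval {p : ℝ[X]} (hp : ∀ j, 0 ≤ p.coeff j) {x : ℝ} (hx : 0 ≤ x) (j : ℕ) :
    p.coeff j * x ^ j ≤ p.eval x := by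
  rw [eval_eq_sum_range]
  by_cases hj : j ≤ p.natDegree
  · exact Finset.single_le_sum (f := fun i => p.coeff i * x ^ i)
      (fun i _ => mul_nonneg (hp i) (pow_nonneg hx i)) (Finset.mem_range.2 (by omega))
  · rw [coeff_eq_zero_of_natDegree_lt (by omega), zero_mul]
    exact Finset.sum_nonneg fun i _ => mul_nonneg (hp i) (pow_nonneg hx i)

lemma T_comp_neg (n : ℤ) (p : ℝ[X]) :
    (T ℝ n).comp (-p) = C ((n.negOnePow : ℤ) : ℝ) * (T ℝ n).comp p := by
  refine funext fun x => ?_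
  simp [eval_comp, T_eval_neg]

lemma abs_coeff_comp_neg_X (p : ℝ[X]) (j : ℕ) : |(p.comp (-X)).coeff j| = |p.coeff j| := by
  have : (-X : ℝ[X]) = C (-1) * X := by simp
  rw [this, comp_C_mul_X_coeff, abs_mul, abs_pow]
  simp

lemma abs_negOnePow (n : ℤ) : |((n.negOnePow : ℤ) : ℝ)| = 1 := by
  rcases Int.even_or_odd n with h | h
  · simp [Int.negOnePow_even n h]
  · simp [Int.negOnePow_odd n h]

/-- By parity, `x ↦ -x` turns `T_n(ax - b)` into `±T_n(ax + b)`, whose coefficients are non-negative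
because `b ≥ 1`; one term is then at most the whole sum. -/
lemma abs_coeff_T_comp_mul_pow_le (n : ℕ) {a b x : ℝ} (ha : 0 ≤ a) (hb : 1 ≤ b) (hx : 0 ≤ x)
    (j : ℕ) :
    |((T ℝ n).comp (C a * X + C (-b))).coeff j| * x ^ j ≤ (T ℝ n).eval (b + a * x) := by
  have hw : ∀ j, 0 ≤ (C (b - 1) + C a * X : ℝ[X]).coeff j := fun j => by
    rw [coeff_add, coeff_C, coeff_C_mul, coeff_X]
    have : 0 ≤ b - 1 := by linarith
    split_ifs <;> simp <;> linarith
  have h := (coeff_T_comp_one_add_nonneg hw n).1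
  have e : |((T ℝ n).comp (C a * X + C (-b))).coeff j| =
      ((T ℝ n).comp (1 + (C (b - 1) + C a * X))).coeff j := by
    rw [← abs_of_nonneg (h j), ← abs_coeff_comp_neg_X ((T ℝ n).comp (1 + _)), comp_assoc]
    have : (1 + (C (b - 1) + C a * X) : ℝ[X]).comp (-X) = -(C a * X + C (-b)) := by
      refine funext fun y => ?_
      simp
      ring
    rw [this, T_comp_neg, coeff_C_mul, abs_mul, abs_negOnePow, one_mul]
  rw [e]
  refine (coeff_mul_pow_le_eval h hx j).trans (le_of_eq ?_)
  rw [eval_comp]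
  congr 1
  simp only [eval_add, eval_one, eval_C, eval_mul, eval_X]
  ring

/-! ### Growth of `T_n` through hyperbolic functions -/

lemma cosh_tangent_le (τ θ : ℝ) :
    Real.cosh τ + Real.sinh τ * (θ - τ) ≤ Real.cosh θ := by
  have h1 : Real.exp τ * (θ - τ + 1) ≤ Real.exp θ := by
    calc Real.exp τ * (θ - τ + 1) ≤ Real.exp τ * Real.exp (θ - τ) := by
          gcongr; exact Real.add_one_le_exp _
      _ = Real.exp θ := by rw [← Real.exp_add]; ring_nf
  have h2 : Real.exp (-τ) * (τ - θ + 1) ≤ Real.exp (-θ) := by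
    calc Real.exp (-τ) * (τ - θ + 1) ≤ Real.exp (-τ) * Real.exp (τ - θ) := by
          gcongr; exact Real.add_one_le_exp _
      _ = Real.exp (-θ) := by rw [← Real.exp_add]; ring_nf
  rw [Real.cosh_eq, Real.sinh_eq, Real.cosh_eq]
  linarith

/-- `T_n(cosh θ) = cosh(nθ) ≤ e^{nθ}`, and the concave `arcosh` lies below its tangent at `cosh τ`.
The point `τ` is free, to be tuned later. -/
lemma eval_T_le_exp (n : ℕ) {τ y : ℝ} (hτ : 0 < τ) (hy : 1 ≤ y) :
    (T ℝ n).eval y ≤ Real.exp (n * (τ + (y - Real.cosh τ) / Real.sinh τ)) := by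
  obtain ⟨θ, hθ, rfl⟩ : ∃ θ, 0 ≤ θ ∧ Real.cosh θ = y :=
    ⟨Real.arcosh y, Real.arcosh_nonneg hy, Real.cosh_arcosh hy⟩
  have hs : 0 < Real.sinh τ := Real.sinh_pos_iff.2 hτ
  have h : θ ≤ τ + (Real.cosh θ - Real.cosh τ) / Real.sinh τ := by
    have := cosh_tangent_le τ θ
    rw [← sub_le_iff_le_add', le_div_iff₀ hs]
    linarith
  rw [T_real_cosh, Int.cast_natCast]
  calc Real.cosh (n * θ) ≤ Real.exp (n * θ) := by
        rw [Real.cosh_eq]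
        have : Real.exp (-(n * θ)) ≤ Real.exp (n * θ) :=
          Real.exp_le_exp.2 (by have : 0 ≤ n * θ := by positivity
                                linarith)
        linarith
    _ ≤ _ := by gcongr

lemma sinh_sub_sinh_le {a b : ℝ} (hb : 0 ≤ b) (hab : b ≤ a) :
    Real.sinh a - Real.sinh b ≤ Real.cosh a * (a - b) := by
  refine Convex.image_sub_le_mul_sub_of_deriv_le (convex_Icc b a)
    Real.continuous_sinh.continuousOn Real.differentiable_sinh.differentiableOn
    (fun x hx => ?_) b (Set.left_mem_Icc.2 hab) a (Set.right_mem_Icc.2 hab) hab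
  rw [interior_Icc] at hx
  rw [Real.deriv_sinh]
  exact Real.cosh_le_cosh.2 (by rw [abs_of_nonneg, abs_of_nonneg] <;> linarith [hx.1, hx.2])

/-- Comparison of the values of `T_n` at two points to the right of `1`. -/
lemma eval_T_le_exp_mul_eval_T (n : ℕ) {s t : ℝ} (ht : 0 ≤ t) (hts : t ≤ s) :
    (T ℝ n).eval (1 + 2 * t ^ 2) ≤
      2 * Real.exp (-(2 * n * ((s - t) / √(1 + s ^ 2)))) * (T ℝ n).eval (1 + 2 * s ^ 2) := by
  -- With `1 + 2u² = cosh(2 arsinh u)` the comparison reduces to a lower bound on `arsinh s - arsinh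
  -- t`, which the mean value inequality for `sinh` supplies.
  have key : ∀ u : ℝ, (T ℝ n).eval (1 + 2 * u ^ 2) = Real.cosh (n * (2 * Real.arsinh u)) := by
    intro u
    have : 1 + 2 * u ^ 2 = Real.cosh (2 * Real.arsinh u) := by
      rw [Real.cosh_two_mul, Real.cosh_sq, Real.sinh_arsinh]; ring
    rw [this, T_real_cosh, Int.cast_natCast]
  set a := Real.arsinh s with ha
  set b := Real.arsinh t with hb
  have hb0 : 0 ≤ b := Real.arsinh_nonneg_iff.2 ht
  have hab : b ≤ a := Real.arsinh_le_arsinh.2 hts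
  have h := sinh_sub_sinh_le hb0 hab
  rw [ha, hb, Real.sinh_arsinh, Real.sinh_arsinh, Real.cosh_arsinh, ← ha, ← hb] at h
  have hd : (s - t) / √(1 + s ^ 2) ≤ a - b := by
    rw [div_le_iff₀ (by positivity)]
    linarith
  rw [key, key, ← ha, ← hb]
  have hm : 2 * n * ((s - t) / √(1 + s ^ 2)) ≤ 2 * n * (a - b) := by gcongr
  have hn : (0 : ℝ) ≤ n * (2 * b) := by positivity
  calc Real.cosh (n * (2 * b)) ≤ Real.exp (n * (2 * b)) := by
        rw [Real.cosh_eq]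
        have : Real.exp (-(n * (2 * b))) ≤ Real.exp (n * (2 * b)) :=
          Real.exp_le_exp.2 (by linarith)
        linarith
    _ ≤ Real.exp (-(2 * n * ((s - t) / √(1 + s ^ 2)))) * Real.exp (n * (2 * a)) := by
        rw [← Real.exp_add]
        exact Real.exp_le_exp.2 (by linarith)
    _ ≤ Real.exp (-(2 * n * ((s - t) / √(1 + s ^ 2)))) * (2 * Real.cosh (n * (2 * a))) := by
        gcongr
        rw [Real.cosh_eq]
        linarith [Real.exp_pos (-(n * (2 * a)))]
    _ = _ := by ring

/-- A weak Stirling bound; the induction step is `e ≤ (1 + 1/j)^{j+1}`. -/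
lemma factorial_mul_exp_le {j : ℕ} (hj : 1 ≤ j) :
    (j ! : ℝ) * Real.exp j ≤ Real.exp 1 * j * (j : ℝ) ^ j := by
  induction j, hj using Nat.le_induction with
  | base => simp
  | succ j hj ih =>
    have hj0 : (0 : ℝ) < j := by exact_mod_cast hj
    have h : Real.exp 1 * (j : ℝ) ^ (j + 1) ≤ ((j : ℝ) + 1) ^ (j + 1) := by
      have h1 : 1 / ((j : ℝ) + 1) ≤ Real.log (((j : ℝ) + 1) / j) := by
        have := Real.one_sub_inv_le_log_of_pos (x := ((j : ℝ) + 1) / j) (by positivity)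
        refine le_trans (le_of_eq ?_) this
        field_simp
        ring
      have h2 : Real.exp 1 ≤ (((j : ℝ) + 1) / j) ^ (j + 1) := by
        rw [← Real.exp_log (x := (((j : ℝ) + 1) / j) ^ (j + 1)) (by positivity), Real.log_pow]
        apply Real.exp_le_exp.2
        calc (1 : ℝ) = ((j + 1 : ℕ) : ℝ) * (1 / ((j : ℝ) + 1)) := by
              push_cast; field_simp
          _ ≤ _ := by gcongr
      rwa [div_pow, le_div_iff₀ (by positivity)] at h2
    calc (((j + 1)! : ℕ) : ℝ) * Real.exp ((j + 1 : ℕ) : ℝ)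
        = ((j : ℝ) + 1) * Real.exp 1 * ((j ! : ℝ) * Real.exp j) := by
          rw [Nat.factorial_succ]; push_cast; rw [Real.exp_add]; ring
      _ ≤ ((j : ℝ) + 1) * Real.exp 1 * (Real.exp 1 * j * (j : ℝ) ^ j) := by gcongr
      _ = ((j : ℝ) + 1) * Real.exp 1 * (Real.exp 1 * (j : ℝ) ^ (j + 1)) := by ring
      _ ≤ ((j : ℝ) + 1) * Real.exp 1 * (((j : ℝ) + 1) ^ (j + 1)) := by gcongr
      _ = _ := by push_cast; ring

/-! ### The shifted Chebyshev polynomial and the weights -/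

lemma abs_eval_T_neg (n : ℤ) (x : ℝ) : |(T ℝ n).eval (-x)| = |(T ℝ n).eval x| := by
  rw [T_eval_neg, abs_mul, abs_negOnePow, one_mul]

lemma left_endpoint_eq {l r : ℝ} (hlr : l < r) :
    (-r - l) / (r - l) = -(1 + 2 * (l / (r - l))) := by
  have : r - l ≠ 0 := by linarith
  field_simp
  ring

lemma one_le_eval_T_left {l r : ℝ} (hl : 0 ≤ l) (hlr : l < r) (L : ℕ) :
    1 ≤ (T ℝ L).eval (1 + 2 * (l / (r - l))) := by
  have : 0 < r - l := by linarith
  have : 0 ≤ l / (r - l) := by positivity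
  exact one_le_eval_T_real _ (by linarith)

lemma abs_chebPoly_eval {l r : ℝ} (hl : 0 ≤ l) (hlr : l < r) (L : ℕ) (p : ℝ) :
    |(chebPoly l r L).eval p| = |(T ℝ L).eval ((2 * p - r - l) / (r - l))| /
      (T ℝ L).eval (1 + 2 * (l / (r - l))) := by
  have h1 := one_le_eval_T_left hl hlr L
  have e : 2 / (r - l) * p + (-r - l) / (r - l) = (2 * p - r - l) / (r - l) := by
    have : r - l ≠ 0 := by linarith
    field_simp
    ring
  rw [chebPoly, eval_mul, eval_C, eval_comp, eval_add, eval_mul, eval_C, eval_X, eval_C, e, abs_mul,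
    abs_neg, abs_inv, left_endpoint_eq hlr, abs_eval_T_neg,
    abs_of_nonneg (a := (T ℝ L).eval (1 + 2 * (l / (r - l)))) (by linarith), inv_mul_eq_div]

lemma sqrt_div_sqrt_one_add {l r q : ℝ} (hr : 0 < r) (hlr : l < r) (hl : 0 ≤ l) :
    √(q / (r - l)) / √(1 + √(l / (r - l)) ^ 2) = √(q / r) := by
  have : 0 < r - l := by linarith
  rw [Real.sq_sqrt (by positivity)]
  have e : 1 + l / (r - l) = r / (r - l) := by field_simp; ring
  rw [e, ← Real.sqrt_div' _ (by positivity)]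
  congr 1
  field_simp

lemma one_le_two_mul_exp_mul_eval_T {l r : ℝ} (hl : 0 ≤ l) (hlr : l < r) (L : ℕ) :
    1 ≤ 2 * Real.exp (-(2 * L * √(l / r))) * (T ℝ L).eval (1 + 2 * (l / (r - l))) := by
  have hd : 0 < r - l := by linarith
  have := eval_T_le_exp_mul_eval_T L (s := √(l / (r - l))) (t := 0) le_rfl (Real.sqrt_nonneg _)
  rw [sub_zero, sqrt_div_sqrt_one_add (by linarith) hlr hl, Real.sq_sqrt (by positivity)] at this
  simpa using this

/-- For `p ≥ l` the second square root is 0, being that of a non-positive number, so one formula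
covers both sides of `l`. -/
lemma abs_chebPoly_eval_le {l r p : ℝ} (hl : 0 ≤ l) (hlr : l < r) (hp : 0 ≤ p) (hpr : p ≤ r)
    (L : ℕ) :
    |(chebPoly l r L).eval p| ≤ 2 * Real.exp (-(2 * L * (√(l / r) - √((l - p) / r)))) := by
  have hd : 0 < r - l := by linarith
  have h1 := one_le_eval_T_left hl hlr L
  rw [abs_chebPoly_eval hl hlr, div_le_iff₀ (by linarith)]
  rcases le_total p l with hpl | hpl
  · have hlp : 0 ≤ l - p := by linarith
    have e : (2 * p - r - l) / (r - l) = -(1 + 2 * √((l - p) / (r - l)) ^ 2) := by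
      rw [Real.sq_sqrt (by positivity)]
      field_simp
      ring
    have h := eval_T_le_exp_mul_eval_T L (Real.sqrt_nonneg ((l - p) / (r - l)))
      (Real.sqrt_le_sqrt (show (l - p) / (r - l) ≤ l / (r - l) by gcongr; linarith))
    rw [sub_div (√(l / (r - l))), sqrt_div_sqrt_one_add (by linarith) hlr hl,
      sqrt_div_sqrt_one_add (by linarith) hlr hl,
      Real.sq_sqrt (show 0 ≤ l / (r - l) by positivity)] at h
    rw [e, abs_eval_T_neg, abs_of_nonneg]
    · exact h
    · exact zero_le_one.trans (one_le_eval_T_real _ (by nlinarith [sq_nonneg (√((l - p) / (r - l)))]))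
  · rw [Real.sqrt_eq_zero_of_nonpos (x := (l - p) / r)
      (div_nonpos_of_nonpos_of_nonneg (by linarith) (by linarith)), sub_zero]
    refine (abs_eval_T_real_le_one _ ?_).trans (one_le_two_mul_exp_mul_eval_T hl hlr L)
    rw [abs_le]
    constructor
    · rw [le_div_iff₀ hd]; linarith
    · rw [div_le_iff₀ hd]; linarith

lemma exp_mul_abs_chebPoly_eval_le {l r p A : ℝ} {n : ℕ} (hl : 0 ≤ l) (hlr : l < r) (hp : 0 ≤ p)
    {L : ℕ} (hA : A ≤ Real.exp (n * r))
    (hT : ∀ z, 0 ≤ z → (T ℝ L).eval (1 + 2 * (z / (r - l))) ≤ A * Real.exp (n * z)) :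
    Real.exp (-(n * p)) * |(chebPoly l r L).eval p| ≤
      2 * Real.exp (-(2 * L * (√(l / r) - √((l - p) / r)))) := by
  rcases le_total p r with hpr | hpr
  · refine le_trans ?_ (abs_chebPoly_eval_le hl hlr hp hpr L)
    exact mul_le_of_le_one_left (abs_nonneg _) (Real.exp_le_one_iff.2 (by
      have : 0 ≤ n * p := by positivity
      linarith))
  · have hd : 0 < r - l := by linarith
    have h1 := one_le_eval_T_left hl hlr L
    rw [Real.sqrt_eq_zero_of_nonpos (x := (l - p) / r)
      (div_nonpos_of_nonpos_of_nonneg (by linarith) (by linarith)), sub_zero,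
      abs_chebPoly_eval hl hlr, ← mul_div_assoc, div_le_iff₀ (by linarith)]
    refine le_trans ?_ (one_le_two_mul_exp_mul_eval_T hl hlr L)
    have e : (2 * p - r - l) / (r - l) = 1 + 2 * ((p - r) / (r - l)) := by
      field_simp
      ring
    have hpr' : 0 ≤ p - r := by linarith
    rw [e, abs_of_nonneg (zero_le_one.trans (one_le_eval_T_real _ (by
      have : 0 ≤ (p - r) / (r - l) := by positivity
      linarith)))]
    calc Real.exp (-(n * p)) * (T ℝ L).eval (1 + 2 * ((p - r) / (r - l)))
        ≤ Real.exp (-(n * p)) * (Real.exp (n * r) * Real.exp (n * (p - r))) := by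
          gcongr
          exact (hT _ hpr').trans (by gcongr)
      _ = 1 := by
          rw [← Real.exp_add, ← Real.exp_add]
          convert Real.exp_zero using 2
          ring

lemma abs_chebCoeff_le {l r A : ℝ} {n : ℕ} (hn : 1 ≤ n) (hl : 0 ≤ l) (hlr : l < r) {L : ℕ}
    (hT : ∀ z, 0 ≤ z → (T ℝ L).eval (1 + 2 * (z / (r - l))) ≤ A * Real.exp (n * z)) (j : ℕ) :
    |chebCoeff n l r L j| ≤ Real.exp 1 * L * (A * Real.exp (n * l)) := by
  have hA : 0 ≤ A := by
    have := hT 0 le_rfl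
    simp at this
    linarith
  rw [chebCoeff]
  split_ifs with hj
  swap
  · rw [abs_zero]; positivity
  have hd : 0 < r - l := by linarith
  have hn0 : (0 : ℝ) < n := by exact_mod_cast hn
  have hj0 : (0 : ℝ) < j := by exact_mod_cast hj.1
  have h1 := one_le_eval_T_left hl hlr L
  have hc : |(chebPoly l r L).coeff j| * ((j : ℝ) / n) ^ j ≤
      A * Real.exp (n * l) * Real.exp j := by
    -- The point `x = j/n` minimises `e^{nx} x^{-j}`; the resulting `e^j` is later cancelled by
    -- `j!/j^j`.
    have h2 := abs_coeff_T_comp_mul_pow_le L (a := 2 / (r - l)) (b := 1 + 2 * (l / (r - l)))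
      (x := (j : ℝ) / n) (by positivity) (by
        have : 0 ≤ l / (r - l) := by positivity
        linarith) (by positivity) j
    have h3 : |(chebPoly l r L).coeff j| ≤ |((T ℝ L).comp (C (2 / (r - l)) * X +
        C (-(1 + 2 * (l / (r - l)))))).coeff j| := by
      rw [chebPoly, left_endpoint_eq hlr, coeff_C_mul, abs_mul]
      refine mul_le_of_le_one_left (abs_nonneg _) ?_
      rw [abs_neg, abs_inv, abs_eval_T_neg, abs_of_nonneg (by linarith)]
      exact inv_le_one_of_one_le₀ h1
    calc _ ≤ _ := mul_le_mul_of_nonneg_right h3 (by positivity)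
      _ ≤ _ := h2
      _ = (T ℝ L).eval (1 + 2 * ((l + j / n) / (r - l))) := by congr 1; ring
      _ ≤ A * Real.exp (n * (l + j / n)) := hT _ (by positivity)
      _ = _ := by
        rw [mul_assoc, ← Real.exp_add]
        congr 2
        field_simp
  have hf := factorial_mul_exp_le hj.1
  have hjL : (j : ℝ) ≤ L := by exact_mod_cast hj.2
  rw [abs_div, abs_mul, Nat.abs_cast, abs_of_nonneg (a := (n : ℝ) ^ j) (by positivity)]
  have e : |(chebPoly l r L).coeff j| * (j ! : ℝ) / (n : ℝ) ^ j =
      (|(chebPoly l r L).coeff j| * ((j : ℝ) / n) ^ j) * ((j ! : ℝ) / (j : ℝ) ^ j) := by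
    rw [div_pow]
    field_simp
  rw [e]
  calc _ ≤ A * Real.exp (n * l) * Real.exp j * ((j ! : ℝ) / (j : ℝ) ^ j) := by gcongr
    _ = A * Real.exp (n * l) * ((j ! : ℝ) * Real.exp j / (j : ℝ) ^ j) := by ring
    _ ≤ A * Real.exp (n * l) * (Real.exp 1 * j) := by
        gcongr
        rw [div_le_iff₀ (by positivity)]
        exact hf
    _ ≤ A * Real.exp (n * l) * (Real.exp 1 * L) := by gcongr
    _ = _ := by ring

lemma natDegree_chebPoly_le (l r : ℝ) (L : ℕ) : (chebPoly l r L).natDegree ≤ L := by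
  rw [chebPoly]
  refine (natDegree_C_mul_le _ _).trans (natDegree_comp_le.trans ?_)
  have h1 : (T ℝ L).natDegree ≤ L := by simp [natDegree_T]
  have h2 : (C (2 / (r - l)) * X + C ((-r - l) / (r - l)) : ℝ[X]).natDegree ≤ 1 :=
    natDegree_linear_le
  simpa using Nat.mul_le_mul h1 h2

lemma chebPoly_coeff_zero {l r : ℝ} (hl : 0 ≤ l) (hlr : l < r) (L : ℕ) :
    (chebPoly l r L).coeff 0 = -1 := by
  have h0 : (T ℝ L).eval ((-r - l) / (r - l)) ≠ 0 := by
    rw [← abs_pos, left_endpoint_eq hlr, abs_eval_T_neg, abs_pos]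
    linarith [one_le_eval_T_left hl hlr L]
  rw [coeff_zero_eq_eval_zero, chebPoly, eval_mul, eval_C, eval_comp, eval_add, eval_mul, eval_C,
    eval_X, eval_C, mul_zero, zero_add, neg_mul, inv_mul_cancel₀ h0]

/-- The expected error contributed by a symbol of mass `p`. -/
lemma integral_chebWeight_sub_one {l r : ℝ} {n : ℕ} (hn : 1 ≤ n) (hl : 0 ≤ l) (hlr : l < r) (L : ℕ)
    (p : ℝ≥0) :
    ∫ x, (chebWeight n l r L x - 1) ∂(poissonMeasure (n * p)) =
      Real.exp (-(n * p)) * (chebPoly l r L).eval (p : ℝ) := by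
  have hn0 : (n : ℝ) ≠ 0 := by exact_mod_cast (by omega : n ≠ 0)
  -- The constant coefficient `-1` lets `j = 0` obey the same formula as `1 ≤ j ≤ L`.
  have hw : ∀ j, chebWeight n l r L j - 1 =
      if j ≤ L then (chebPoly l r L).coeff j * (j ! : ℝ) / (n : ℝ) ^ j else 0 := by
    intro j
    rcases Nat.eq_zero_or_pos j with rfl | hj
    · simp [chebWeight, chebPoly_coeff_zero hl hlr]
    · have hj1 : 1 ≤ j := hj
      rw [chebWeight, if_neg hj.ne', add_sub_cancel_right, chebCoeff]
      simp only [hj1, true_and]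
  rw [integral_poissonMeasure, tsum_eq_sum (s := Finset.range (L + 1)),
    eval_eq_sum_range' (Nat.lt_succ_of_le (natDegree_chebPoly_le l r L)), Finset.mul_sum]
  · refine Finset.sum_congr rfl fun j hj => ?_
    rw [hw, if_pos (Nat.lt_succ_iff.1 (Finset.mem_range.1 hj)), smul_eq_mul, NNReal.coe_mul,
      NNReal.coe_natCast, mul_pow]
    have : (j ! : ℝ) ≠ 0 := by positivity
    field_simp
  · intro j hj
    rw [hw, if_neg (fun h => hj (Finset.mem_range.2 (by omega))), smul_zero]

/-! ### The Poissonized model -/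

lemma finite_support_of_mem_paramSpace {k : ℕ} (hk : 1 ≤ k) {P : PMF ℕ} (hP : P ∈ paramSpace k) :
    P.support.Finite := by
  have hk' : (0 : ℝ) < 1 / k := by
    have : (0 : ℝ) < k := by exact_mod_cast hk
    positivity
  refine (ENNReal.finite_const_le_of_tsum_ne_top (a := P) (by simp [P.tsum_coe])
    (ε := ENNReal.ofReal (1 / k)) (by rw [Ne, ENNReal.ofReal_eq_zero]; exact not_le.2 hk')).subset fun i hi => ?_
  exact (ENNReal.ofReal_le_iff_le_toReal (P.apply_ne_top i)).2 (hP i hi)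

/-- Second moment of a sum of bounded, pairwise independent random variables. -/
lemma integral_sq_sum_le {Ω ι : Type*} [MeasurableSpace Ω] {μ : Measure Ω} [IsProbabilityMeasure μ]
    (s : Finset ι) {X : ι → Ω → ℝ} (hX : ∀ i, AEMeasurable (X i) μ)
    (hind : Pairwise fun i j => IndepFun (X i) (X j) μ) {B b : ℝ} (hB : ∀ i ω, |X i ω| ≤ B)
    (hb : ∀ i ∈ s, |∫ ω, X i ω ∂μ| ≤ b) :
    Integrable (fun ω => (∑ i ∈ s, X i ω) ^ 2) μ ∧
      ∫ ω, (∑ i ∈ s, X i ω) ^ 2 ∂μ ≤ (s.card : ℝ) ^ 2 * b ^ 2 + s.card * B ^ 2 := by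
  have hL : ∀ i, MemLp (X i) 2 μ := fun i =>
    MemLp.of_bound (hX i).aestronglyMeasurable B (Filter.Eventually.of_forall (hB i))
  have hS : MemLp (∑ i ∈ s, X i) 2 μ := memLp_finsetSum' s fun i _ => hL i
  have hfun : (∑ i ∈ s, X i) = fun ω => ∑ i ∈ s, X i ω := by ext; simp
  have hint : Integrable (fun ω => (∑ i ∈ s, X i ω) ^ 2) μ := by
    have := hS.integrable_sq
    rwa [hfun] at this
  refine ⟨hint, ?_⟩
  have hv := variance_eq_sub hS
  rw [IndepFun.variance_sum (fun i _ => hL i) (fun i _ j _ hij => hind hij)] at hv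
  have hvar : ∑ i ∈ s, variance (X i) μ ≤ s.card * B ^ 2 := by
    rw [← nsmul_eq_mul]
    refine Finset.sum_le_card_nsmul _ _ _ fun i _ => ?_
    refine (variance_le_expectation_sq (hX i).aestronglyMeasurable).trans ?_
    calc ∫ ω, (X i ^ 2) ω ∂μ ≤ ∫ _, B ^ 2 ∂μ := by
          refine integral_mono (hL i).integrable_sq (integrable_const _) fun ω => ?_
          simpa using sq_le_sq' (abs_le.1 (hB i ω)).1 (abs_le.1 (hB i ω)).2
      _ = B ^ 2 := by simp
  have hmean : (∫ ω, (∑ i ∈ s, X i) ω ∂μ) ^ 2 ≤ (s.card : ℝ) ^ 2 * b ^ 2 := by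
    rw [← mul_pow, ← sq_abs]
    refine pow_le_pow_left₀ (abs_nonneg _) ?_ 2
    rw [hfun, integral_finsetSum s fun i _ => (hL i).integrable (by norm_num), ← nsmul_eq_mul]
    exact (Finset.abs_sum_le_sum_abs _ _).trans (Finset.sum_le_card_nsmul _ _ _ hb)
  have e : ∫ ω, (∑ i ∈ s, X i ω) ^ 2 ∂μ = ∫ ω, ((∑ i ∈ s, X i) ^ 2) ω ∂μ := by
    rw [hfun]; rfl
  rw [e]
  linarith

lemma IsPoissonSample.ae_eq_zero {Ω : Type*} [MeasurableSpace Ω] {n : ℕ} {P : PMF ℕ}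
    {N : ℕ → Ω → ℕ} {μ : Measure Ω} (h : IsPoissonSample n P N μ) :
    ∀ᵐ ω ∂μ, ∀ i, P i = 0 → N i ω = 0 := by
  rw [ae_all_iff]
  intro i
  by_cases hi : P i = 0
  · have h1 := h.2 i
    rw [hi, ENNReal.toNNReal_zero, mul_zero] at h1
    have h2 : ∀ᵐ x ∂(poissonMeasure 0), x = 0 := by
      rw [ae_iff_of_countable]
      intro a ha
      by_contra hne
      exact ha (by rw [poissonMeasure_singleton]; simp [hne])
    filter_upwards [(h1.ae_iff (p := fun x => x = 0) (.of_discrete)).2 h2] with ω hω _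
    exact hω
  · exact Filter.Eventually.of_forall fun ω h => absurd h hi

lemma chebWeight_zero (n : ℕ) (l r : ℝ) (L : ℕ) : chebWeight n l r L 0 = 0 := if_pos rfl

/-- Almost surely the error of the estimator is a finite sum over the support. -/
lemma linearEstimator_sub_supportSize_ae_eq {Ω : Type*} [MeasurableSpace Ω] {n : ℕ} {P : PMF ℕ}
    {N : ℕ → Ω → ℕ} {μ : Measure Ω} (h : IsPoissonSample n P N μ) (hfin : P.support.Finite)
    (l r : ℝ) (L : ℕ) :
    (fun ω => linearEstimator n l r L (fun i => N i ω) - supportSize P) =ᵐ[μ]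
      fun ω => ∑ i ∈ hfin.toFinset, (chebWeight n l r L (N i ω) - 1) := by
  filter_upwards [h.ae_eq_zero] with ω hω
  rw [linearEstimator, tsum_eq_sum (s := hfin.toFinset) (fun i hi => ?_), supportSize,
    Set.ncard_eq_toFinset_card _ hfin]
  · simp
  · have : P i = 0 := by simpa using hi
    rw [hω i this, chebWeight_zero]

/-! ### The agnostic parameters -/

lemma log_468_le : Real.log 4.68 ≤ 1.5434 := by
  have h1 : Real.log 1.17 ≤ 0.15705 := by
    rw [Real.log_le_iff_le_exp (by norm_num)]
    refine le_trans ?_ (Real.sum_le_exp_of_nonneg (x := 0.15705) (by norm_num) 4)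
    norm_num [Finset.sum_range_succ, Nat.factorial]
  have h2 : Real.log 4.68 = 2 * Real.log 2 + Real.log 1.17 := by
    rw [← Real.log_rpow (by norm_num), ← Real.log_mul (by norm_num) (by norm_num)]
    norm_num
  linarith [Real.log_two_lt_d9]

section

variable {n : ℕ} {ε : ℝ}

lemma log_pos_and_log_inv_lt (hn : 1 ≤ n) (hε : (n : ℝ) ^ (-(0.01 : ℝ)) < ε) (hε1 : ε < 1) :
    0 < Real.log n ∧ 0 < ε ∧ 0 < Real.log (1 / ε) ∧ Real.log (1 / ε) < 0.01 * Real.log n := by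
  have hn0 : (0 : ℝ) < n := by exact_mod_cast hn
  have hε0 : 0 < ε := (Real.rpow_pos_of_pos hn0 _).trans hε
  have h1 : 0 < Real.log (1 / ε) := Real.log_pos (by rw [lt_div_iff₀ hε0]; linarith)
  have h2 : Real.log (1 / ε) < 0.01 * Real.log n := by
    have := Real.log_lt_log (Real.rpow_pos_of_pos hn0 _) hε
    rw [Real.log_rpow hn0] at this
    rw [one_div, Real.log_inv]
    linarith
  exact ⟨by linarith, hε0, h1, h2⟩

lemma agnosticRight_pos (hn : 1 ≤ n) (hΛ : 0 < Real.log n) : 0 < agnosticRight n := by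
  have hn0 : (0 : ℝ) < n := by exact_mod_cast hn
  unfold agnosticRight c₁
  positivity

lemma agnosticLeft_pos (hn : 1 ≤ n) (hΛ : 0 < Real.log n) (hE : 0 < Real.log (1 / ε)) :
    0 < agnosticLeft n ε := by
  have hn0 : (0 : ℝ) < n := by exact_mod_cast hn
  unfold agnosticLeft c₁ c₀
  positivity

lemma left_div_right (hn : 1 ≤ n) (hΛ : 0 < Real.log n) :
    agnosticLeft n ε / agnosticRight n = (Real.log (1 / ε) / (c₀ * Real.log n)) ^ 2 := by
  have hn0 : (0 : ℝ) < n := by exact_mod_cast hn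
  have h0 : c₀ ≠ 0 := by norm_num [c₀]
  have h1 : c₁ ≠ 0 := by norm_num [c₁]
  unfold agnosticLeft agnosticRight
  field_simp

lemma agnosticLeft_le (hn : 1 ≤ n) (hΛ : 0 < Real.log n) (hE : 0 < Real.log (1 / ε))
    (hEΛ : Real.log (1 / ε) < 0.01 * Real.log n) :
    agnosticLeft n ε ≤ 0.00033 * agnosticRight n := by
  rw [← div_le_iff₀ (agnosticRight_pos hn hΛ), left_div_right hn hΛ]
  have h : Real.log (1 / ε) / (c₀ * Real.log n) ≤ 0.018 := by
    rw [c₀, div_le_iff₀ (by positivity)]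
    nlinarith
  have h0 : 0 ≤ Real.log (1 / ε) / (c₀ * Real.log n) := by
    rw [c₀]; positivity
  nlinarith

lemma agnosticDegree_le (hΛ : 0 < Real.log n) : (agnosticDegree n : ℝ) ≤ 0.558 * Real.log n :=
  Nat.floor_le (by rw [c₀]; positivity)

/-- Exponential growth of the shifted Chebyshev polynomial, with rate at most `n`. -/
lemma eval_T_agnostic_le (hn : 1 ≤ n) (hΛ : 0 < Real.log n)
    (hlr : agnosticLeft n ε ≤ 0.00033 * agnosticRight n) {z : ℝ} (hz : 0 ≤ z) :
    (T ℝ (agnosticDegree n)).eval (1 + 2 * (z / (agnosticRight n - agnosticLeft n ε))) ≤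
      Real.exp (0.4997 * Real.log n) * Real.exp (n * z) := by
  have hn0 : (0 : ℝ) < n := by exact_mod_cast hn
  have hr := agnosticRight_pos hn hΛ
  have hL := agnosticDegree_le hΛ
  have hnr : n * agnosticRight n = 0.5 * Real.log n := by
    rw [agnosticRight, c₁]; field_simp
  set l := agnosticLeft n ε
  set r := agnosticRight n
  set L := agnosticDegree n
  have hL0 : (0 : ℝ) ≤ L := Nat.cast_nonneg L
  have hd : 0 < r - l := by linarith
  -- Chosen so that `sinh τ` just exceeds `2c₀/c₁ = 2.232`, with room for `r - l` in place of `r`: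
  -- the slope in `z` is then at most `n`, and the constant term `0.558 · 0.895514` stays below
  -- `1/2`.
  set τ := Real.log 4.68 with hτ
  have hτ0 : 0 < τ := Real.log_pos (by norm_num)
  have hτ1 : τ ≤ 1.5434 := log_468_le
  have hsinh : Real.sinh τ = (4.68 - 4.68⁻¹) / 2 := Real.sinh_log (by norm_num)
  have hcosh : Real.cosh τ = (4.68 + 4.68⁻¹) / 2 := Real.cosh_log (by norm_num)
  refine (eval_T_le_exp L hτ0 (by
    have : 0 ≤ z / (r - l) := by positivity
    linarith)).trans ?_
  rw [← Real.exp_add]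
  refine Real.exp_le_exp.2 ?_
  have hs0 : 0 < Real.sinh τ := by rw [hsinh]; norm_num
  have h1 : τ - (Real.cosh τ - 1) / Real.sinh τ ≤ 0.895514 := by
    have : (0.647886 : ℝ) ≤ (Real.cosh τ - 1) / Real.sinh τ := by
      rw [hsinh, hcosh]; norm_num
    linarith
  have h2 : 2 * L / ((r - l) * Real.sinh τ) ≤ n := by
    rw [div_le_iff₀ (by positivity)]
    have : 2.2331 ≤ Real.sinh τ := by rw [hsinh]; norm_num
    have h3 : n * (0.99967 * r) ≤ n * (r - l) := by gcongr; linarith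
    calc 2 * (L : ℝ) ≤ n * (0.99967 * r) * 2.2331 := by nlinarith
      _ ≤ n * (r - l) * Real.sinh τ := by gcongr
      _ = _ := by ring
  calc L * (τ + (1 + 2 * (z / (r - l)) - Real.cosh τ) / Real.sinh τ)
      = L * (τ - (Real.cosh τ - 1) / Real.sinh τ) + 2 * L / ((r - l) * Real.sinh τ) * z := by
        field_simp
        ring
    _ ≤ L * 0.895514 + n * z := by gcongr
    _ ≤ _ := by nlinarith

lemma abs_chebWeight_sub_one_le (hn : 1 ≤ n) (hΛ : 0 < Real.log n) (hE : 0 < Real.log (1 / ε))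
    (hEΛ : Real.log (1 / ε) < 0.01 * Real.log n) (j : ℕ) :
    |chebWeight n (agnosticLeft n ε) (agnosticRight n) (agnosticDegree n) j - 1| ≤
      400000 * Real.exp (0.499875 * Real.log n) := by
  have hn0 : (0 : ℝ) < n := by exact_mod_cast hn
  have hr := agnosticRight_pos hn hΛ
  have hl := agnosticLeft_pos hn hΛ hE
  have hlr := agnosticLeft_le hn hΛ hE hEΛ
  have hone : 1 ≤ Real.exp (0.499875 * Real.log n) := Real.one_le_exp (by positivity)
  rw [chebWeight]
  split_ifs with hj
  · norm_num
    linarith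
  · rw [add_sub_cancel_right]
    refine (abs_chebCoeff_le hn hl.le (by linarith)
      (fun z hz => eval_T_agnostic_le hn hΛ hlr hz) j).trans ?_
    have hnr : n * agnosticRight n = 0.5 * Real.log n := by
      rw [agnosticRight, c₁]; field_simp
    have hnl : n * agnosticLeft n ε ≤ 0.000165 * Real.log n := by nlinarith
    -- The logarithmic factor `L` is absorbed in `n^{0.00001}`; the exponents add up to `0.4997 +
    -- 0.000165 + 0.00001`.
    have hL : (agnosticDegree n : ℝ) ≤ 100000 * Real.exp (0.00001 * Real.log n) := by
      have := Real.add_one_le_exp (0.00001 * Real.log n)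
      linarith [agnosticDegree_le hΛ]
    have he : Real.exp 1 ≤ 3 := by linarith [Real.exp_one_lt_d9]
    rw [← Real.exp_add]
    calc _ ≤ 3 * (100000 * Real.exp (0.00001 * Real.log n)) *
          Real.exp (0.4997 * Real.log n + 0.000165 * Real.log n) := by gcongr
      _ = 300000 * Real.exp (0.499875 * Real.log n) := by
        rw [mul_assoc, mul_assoc, ← Real.exp_add, ← mul_assoc]
        congr 2
        · norm_num
        · ring
      _ ≤ _ := by linarith

lemma sqrt_alpha_le_one (n k : ℕ) (ε : ℝ) : √(alpha n k ε) ≤ 1 := by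
  rw [Real.sqrt_le_one, alpha]
  refine max_le (sub_le_self _ ?_) zero_le_one
  have : 0 ≤ Real.log n := Real.log_natCast_nonneg n
  unfold c₀ c₁
  positivity

/-- The quantity subtracted from 1 in `α` is `1/(kl)`, so `l - p ≤ l - 1/k ≤ αl`. -/
lemma sqrt_left_sub_le {k : ℕ} {p : ℝ} (hn : 1 ≤ n) (hk : 1 ≤ k) (hΛ : 0 < Real.log n)
    (hE : 0 < Real.log (1 / ε)) (hp : 1 / (k : ℝ) ≤ p) :
    √((agnosticLeft n ε - p) / agnosticRight n) ≤
      √(alpha n k ε) * √(agnosticLeft n ε / agnosticRight n) := by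
  have hr := agnosticRight_pos hn hΛ
  have hl := agnosticLeft_pos hn hΛ hE
  have hn0 : (0 : ℝ) < n := by exact_mod_cast hn
  have hk0 : (0 : ℝ) < k := by exact_mod_cast hk
  have h0 : c₀ ≠ 0 := by norm_num [c₀]
  have h1 : c₁ ≠ 0 := by norm_num [c₁]
  have e : c₀ ^ 2 / c₁ * (n * Real.log n / (k * Real.log (1 / ε) ^ 2)) * agnosticLeft n ε =
      1 / k := by
    unfold agnosticLeft
    field_simp
  rw [← Real.sqrt_mul (show 0 ≤ alpha n k ε from le_max_right _ _)]
  apply Real.sqrt_le_sqrt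
  rw [← mul_div_assoc]
  gcongr
  calc agnosticLeft n ε - p ≤ agnosticLeft n ε - 1 / k := by linarith
    _ = (1 - c₀ ^ 2 / c₁ * (n * Real.log n / (k * Real.log (1 / ε) ^ 2))) * agnosticLeft n ε := by
      rw [sub_mul, e, one_mul]
    _ ≤ _ := by
      gcongr
      exact le_max_left _ _

lemma exp_mul_abs_chebPoly_agnostic_le {k : ℕ} {p : ℝ} (hn : 1 ≤ n) (hk : 1 ≤ k)
    (hΛ : 0 < Real.log n) (hε0 : 0 < ε) (hE : 0 < Real.log (1 / ε))
    (hEΛ : Real.log (1 / ε) < 0.01 * Real.log n) (hp : 1 / (k : ℝ) ≤ p) :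
    Real.exp (-(n * p)) * |(chebPoly (agnosticLeft n ε) (agnosticRight n)
      (agnosticDegree n)).eval p| ≤ 18 * ε ^ (1 - √(alpha n k ε)) := by
  have hn0 : (0 : ℝ) < n := by exact_mod_cast hn
  have hr := agnosticRight_pos hn hΛ
  have hl := agnosticLeft_pos hn hΛ hE
  have hlr := agnosticLeft_le hn hΛ hE hEΛ
  have hp0 : 0 ≤ p := le_trans (by positivity) hp
  have hnr : n * agnosticRight n = 0.5 * Real.log n := by
    rw [agnosticRight, c₁]; field_simp
  refine (exp_mul_abs_chebPoly_eval_le hl.le (by linarith) hp0 (Real.exp_le_exp.2 (by linarith))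
    (fun z hz => eval_T_agnostic_le hn hΛ hlr hz)).trans ?_
  have hsq := sqrt_left_sub_le hn hk hΛ hE hp
  have hc0 : 0 < c₀ := by norm_num [c₀]
  have hβ : √(agnosticLeft n ε / agnosticRight n) = Real.log (1 / ε) / (c₀ * Real.log n) := by
    rw [left_div_right hn hΛ, Real.sqrt_sq (by positivity)]
  have hα := sqrt_alpha_le_one n k ε
  have hα0 := Real.sqrt_nonneg (alpha n k ε)
  have hL : c₀ * Real.log n < agnosticDegree n + 1 := Nat.lt_floor_add_one _
  have hβE : √(agnosticLeft n ε / agnosticRight n) * (c₀ * Real.log n) = Real.log (1 / ε) := by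
    rw [hβ]; field_simp
  have hβ1 : √(agnosticLeft n ε / agnosticRight n) ≤ 1 := by
    rw [Real.sqrt_le_one, div_le_one hr]; linarith
  have hβ0 := Real.sqrt_nonneg (agnosticLeft n ε / agnosticRight n)
  set b := √(agnosticLeft n ε / agnosticRight n)
  set a := √(alpha n k ε)
  set L := agnosticDegree n
  have hL0 : (0 : ℝ) ≤ L := Nat.cast_nonneg L
  have hε : ε ^ (1 - a) = Real.exp (-(Real.log (1 / ε) * (1 - a))) := by
    rw [Real.rpow_def_of_pos hε0, one_div, Real.log_inv]
    ring_nf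
  -- Rounding `c₀ log n` down to `L` costs at most 2 in the exponent, which gives the constant `18 ≥
  -- 2e²`. Half of the available decay is discarded.
  have hmain : Real.log (1 / ε) * (1 - a) - 2 ≤
      2 * L * (b - √((agnosticLeft n ε - p) / agnosticRight n)) := by
    have h1a : 0 ≤ 1 - a := by linarith
    calc Real.log (1 / ε) * (1 - a) - 2 ≤ 2 * (Real.log (1 / ε) * (1 - a)) - 2 := by
          have : 0 ≤ Real.log (1 / ε) * (1 - a) := by positivity
          linarith
      _ = 2 * (b * (1 - a)) * (c₀ * Real.log n) - 2 := by rw [← hβE]; ring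
      _ ≤ 2 * (b * (1 - a)) * (L + 1) - 2 := by gcongr
      _ ≤ 2 * L * (b - a * b) := by
          have : b * (1 - a) ≤ 1 * 1 := by gcongr; linarith
          linarith
      _ ≤ _ := by gcongr
  have he : Real.exp 2 ≤ 9 := by
    have : Real.exp 2 = Real.exp 1 * Real.exp 1 := by rw [← Real.exp_add]; norm_num
    nlinarith [Real.exp_one_lt_d9, Real.exp_pos 1]
  rw [hε]
  calc 2 * Real.exp (-(2 * L * (b - √((agnosticLeft n ε - p) / agnosticRight n))))
      ≤ 2 * Real.exp (2 + -(Real.log (1 / ε) * (1 - a))) := by gcongr; linarith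
    _ = 2 * Real.exp 2 * Real.exp (-(Real.log (1 / ε) * (1 - a))) := by rw [Real.exp_add]; ring
    _ ≤ _ := by gcongr; linarith

end

end SupportSize

/-! ### The risk bound -/

theorem mainTheorem6 :
    ∃ c : ℝ, c < 1 ∧ ∃ C : ℝ, 0 < C ∧ ∃ C' : ℝ, 0 < C' ∧
      ∀ (n k : ℕ), 1 ≤ n → 1 ≤ k →
      ∀ ε : ℝ, (n : ℝ) ^ (-C) < ε → ε < 1 →
      ∀ P : PMF ℕ, P ∈ SupportSize.paramSpace k →
      ∀ {Ω : Type*} [MeasurableSpace Ω] (μ : Measure Ω) [IsProbabilityMeasure μ]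
        (N : ℕ → Ω → ℕ), SupportSize.IsPoissonSample n P N μ →
        Integrable (fun ω => (SupportSize.agnosticEstimator n ε (fun i => N i ω)
            - SupportSize.supportSize P) ^ 2) μ ∧
        ∫ ω, (SupportSize.agnosticEstimator n ε (fun i => N i ω)
            - SupportSize.supportSize P) ^ 2 ∂μ
          ≤ C' * (SupportSize.supportSize P ^ 2
                * ε ^ (2 * (1 - √(SupportSize.alpha n k ε)))
              + SupportSize.supportSize P * (n : ℝ) ^ c) := by
  -- `c = 2 · 0.499875`; `C = 0.01` makes `l/r` at most `0.00033`; `C'` exceeds both `400000²` and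
  -- `18²`.
  refine ⟨0.99975, by norm_num, 0.01, by norm_num, 10 ^ 12, by norm_num, ?_⟩
  intro n k hn hk ε hε hε1 P hP Ω _ μ _ N hN
  obtain ⟨hΛ, hε0, hE, hEΛ⟩ := SupportSize.log_pos_and_log_inv_lt hn hε hε1
  have hn0 : (0 : ℝ) < n := by exact_mod_cast hn
  have hfin := SupportSize.finite_support_of_mem_paramSpace hk hP
  set w := SupportSize.chebWeight n (SupportSize.agnosticLeft n ε) (SupportSize.agnosticRight n)
    (SupportSize.agnosticDegree n) with hw
  have hS : SupportSize.supportSize P = hfin.toFinset.card := by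
    rw [SupportSize.supportSize, Set.ncard_eq_toFinset_card _ hfin]
  have hX : ∀ i, AEMeasurable (fun ω => w (N i ω) - 1) μ := fun i =>
    (Measurable.of_discrete (f := fun j => w j - 1)).comp_aemeasurable (hN.2 i).aemeasurable
  have hind : Pairwise fun i j =>
      IndepFun (fun ω => w (N i ω) - 1) (fun ω => w (N j ω) - 1) μ := fun i j hij =>
    (hN.1.indepFun hij).comp (Measurable.of_discrete (f := fun j => w j - 1))
      (Measurable.of_discrete (f := fun j => w j - 1))
  have hmean : ∀ i ∈ hfin.toFinset, |∫ ω, (w (N i ω) - 1) ∂μ| ≤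
      18 * ε ^ (1 - √(SupportSize.alpha n k ε)) := by
    intro i hi
    have hlr := SupportSize.agnosticLeft_le hn hΛ hE hEΛ
    have hr := SupportSize.agnosticRight_pos hn hΛ
    have h1 := (hN.2 i).integral_comp (f := fun j => w j - 1) .of_discrete
    have h2 := SupportSize.integral_chebWeight_sub_one
      (r := SupportSize.agnosticRight n) hn
      (SupportSize.agnosticLeft_pos hn hΛ hE).le (by linarith) (SupportSize.agnosticDegree n)
      (P i).toNNReal
    have h3 : ∫ ω, (w (N i ω) - 1) ∂μ = _ := h1.trans h2
    rw [h3, abs_mul, Real.abs_exp]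
    exact SupportSize.exp_mul_abs_chebPoly_agnostic_le hn hk hΛ hε0 hE hEΛ
      (hP i ((P.mem_support_iff i).1 (hfin.mem_toFinset.1 hi)))
  obtain ⟨hint, hle⟩ := SupportSize.integral_sq_sum_le hfin.toFinset hX hind
    (fun i ω => SupportSize.abs_chebWeight_sub_one_le hn hΛ hE hEΛ (N i ω)) hmean
  have hae : (fun ω => (SupportSize.agnosticEstimator n ε (fun i => N i ω)
      - SupportSize.supportSize P) ^ 2) =ᵐ[μ]
      fun ω => (∑ i ∈ hfin.toFinset, (w (N i ω) - 1)) ^ 2 :=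
    (SupportSize.linearEstimator_sub_supportSize_ae_eq hN hfin _ _ _).fun_comp (· ^ 2)
  refine ⟨hint.congr hae.symm, ?_⟩
  rw [integral_congr_ae hae, hS]
  refine hle.trans ?_
  have e1 : (ε ^ (1 - √(SupportSize.alpha n k ε))) ^ 2 =
      ε ^ (2 * (1 - √(SupportSize.alpha n k ε))) := by
    rw [← Real.rpow_natCast, ← Real.rpow_mul hε0.le]
    congr 1
    push_cast
    ring
  have e2 : Real.exp (0.499875 * Real.log n) ^ 2 = (n : ℝ) ^ (0.99975 : ℝ) := by
    rw [Real.rpow_def_of_pos hn0, ← Real.exp_nat_mul]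
    congr 1
    push_cast
    ring
  rw [mul_pow, mul_pow, e1, e2, mul_add]
  have p1 : 0 ≤ (hfin.toFinset.card : ℝ) ^ 2 * ε ^ (2 * (1 - √(SupportSize.alpha n k ε))) := by
    positivity
  have p2 : 0 ≤ (hfin.toFinset.card : ℝ) * (n : ℝ) ^ (0.99975 : ℝ) := by positivity
  nlinarith
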